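/- Theorem (Kunz-type theorem for formal unramification). Let $p$ be a prime number and let $f\colon X\to S$ be a morphism of schemes over $\mathbb{F}_p$. Let $F_X\colon X\to X$ and $F_S\colon S\to S$ denote the absolute Frobenius endomorphisms (the identity on points and $s\mapsto s^p$ on sections of the structure sheaf), let $X^{(p)} := X\times_{f,S,F_S} S$ be the base change of $f$ along $F_S$, and let $F_f\colon X\to X^{(p)}$ be the relative Frobenius of $f$, that is, the unique morphism whose composition with the projection $X^{(p)}\to X$ is $F_X$ and whose composition with the projection $X^{(p)}\to S$ is $f$. Assume that both $X$ and $X^{(p)}$ are locally noetherian schemes ($S$ is not assumed to be locally noetherian). If $f$ is formally unramified, then $F_f$ is a closed immersion. -/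

import Mathlib

open CategoryTheory CategoryTheory.Limits AlgebraicGeometry TopologicalSpace Opposite

universe u

namespace RelFrob

/-- `X` is an `𝔽_p`-scheme: it admits a (necessarily unique) morphism to `Spec 𝔽_p`. -/
class IsFpScheme (p : ℕ) (X : Scheme.{u}) : Prop where
  nonempty_hom : Nonempty (X ⟶ Spec (CommRingCat.of (ULift.{u} (ZMod p))))

/-- On an `𝔽_p`-scheme, `p = 0` in every ring of sections. -/
theorem natCast_eq_zero (p : ℕ) (X : Scheme.{u}) [IsFpScheme p X] (U : X.Opens) :
    ((p : ℕ) : Γ(X, U)) = 0 := by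
  obtain ⟨g⟩ := IsFpScheme.nonempty_hom (p := p) (X := X)
  let φ : ZMod p →+* Γ(X, U) :=
    ((X.presheaf.map (homOfLE (le_top : U ≤ ⊤)).op).hom.comp
      ((Scheme.ΓSpecIso _).inv ≫ g.appTop).hom).comp
      (ULift.ringEquiv (R := ZMod p)).symm.toRingHom
  rw [← map_natCast φ, ZMod.natCast_self, map_zero]

/-- The Frobenius endomorphism `x ↦ x ^ p` of a commutative ring in which the prime `p` vanishes
(the zero ring is allowed). -/
def frob {R : Type*} [CommRing R] (p : ℕ) [Fact p.Prime] (hp : (p : R) = 0) : R →+* R where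
  toFun x := x ^ p
  map_one' := one_pow p
  map_mul' x y := mul_pow x y p
  map_zero' := zero_pow (Fact.out : p.Prime).ne_zero
  map_add' x y := by
    have h := add_pow_prime_eq (Fact.out : p.Prime) x y
    rw [h, hp]; simp

variable (p : ℕ) [Fact p.Prime]

/-- The map of sheaves of rings `𝒪_X → 𝒪_X`, `s ↦ s ^ p`. -/
noncomputable def absFrobPresheafHom (X : Scheme.{u}) [IsFpScheme p X] :
    X.presheaf ⟶ (TopCat.Presheaf.pushforward CommRingCat (𝟙 _)).obj X.presheaf where
  app U := CommRingCat.ofHom (frob p (natCast_eq_zero p X U.unop))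
  naturality U V i := by
    ext x
    exact (map_pow (X.presheaf.map i).hom x p).symm

/-- The absolute Frobenius as a morphism of presheafed spaces: the identity on points and
`s ↦ s ^ p` on sections. -/
noncomputable def absFrobPresheafed (X : Scheme.{u}) [IsFpScheme p X] :
    X.toPresheafedSpace ⟶ X.toPresheafedSpace where
  base := 𝟙 _
  c := absFrobPresheafHom p X

theorem absFrobPresheafed_stalkMap (X : Scheme.{u}) [IsFpScheme p X] (x : X)
    (s : X.presheaf.stalk x) :
    ((absFrobPresheafed p X).stalkMap x).hom s = s ^ p := by
  obtain ⟨U, hx, t, rfl⟩ := X.presheaf.exists_germ_eq s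
  have := congr($(PresheafedSpace.stalkMap_germ (absFrobPresheafed p X) U x hx).hom t)
  refine this.trans ?_
  exact map_pow (X.presheaf.germ U x hx).hom t p

/-- The absolute Frobenius endomorphism `F_X : X ⟶ X` of an `𝔽_p`-scheme. -/
noncomputable def absFrob (X : Scheme.{u}) [IsFpScheme p X] : X ⟶ X :=
  Scheme.Hom.mk
    { toHom := absFrobPresheafed p X
      prop := fun x => ⟨fun s hs => by
        have h : IsUnit (M := X.presheaf.stalk x) (HPow.hPow (α := X.presheaf.stalk x) s p) :=
          (congrArg IsUnit (absFrobPresheafed_stalkMap p X x s)).mp hs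
        exact (isUnit_pow_iff (Fact.out : p.Prime).ne_zero).mp h⟩ }

theorem absFrob_base (X : Scheme.{u}) [IsFpScheme p X] (x : X) : absFrob p X x = x := rfl

theorem absFrob_app (X : Scheme.{u}) [IsFpScheme p X] (U : X.Opens) (s : Γ(X, U)) :
    ((absFrob p X).app U).hom s = s ^ p := rfl

/-- The absolute Frobenius commutes with every morphism of `𝔽_p`-schemes. -/
theorem absFrob_comp {X S : Scheme.{u}} [IsFpScheme p X] [IsFpScheme p S] (f : X ⟶ S) :
    absFrob p X ≫ f = f ≫ absFrob p S := by
  refine Scheme.Hom.ext rfl fun U => ?_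
  ext s
  have h : ∀ t : Γ(X, f ⁻¹ᵁ U),
      (X.presheaf.map (eqToHom rfl : op (f ⁻¹ᵁ U) ⟶ op (f ⁻¹ᵁ U))).hom t = t := fun t =>
    congr($(X.presheaf.map_id (op (f ⁻¹ᵁ U))).hom t)
  simp only [Scheme.Hom.comp_app]
  exact (h _).trans (map_pow (f.app U).hom s p).symm

/-- The Frobenius twist `X^{(p)} = X ×_{S, F_S} S` of `f : X ⟶ S`. -/
noncomputable abbrev frobTwist {X S : Scheme.{u}} (f : X ⟶ S) [IsFpScheme p S] : Scheme.{u} :=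
  pullback f (absFrob p S)

/-- The relative Frobenius `F_f : X ⟶ X^{(p)}`: the unique morphism whose composition with the
projection `X^{(p)} ⟶ X` is `F_X` and whose composition with `X^{(p)} ⟶ S` is `f`. -/
noncomputable def relFrob {X S : Scheme.{u}} [IsFpScheme p X] [IsFpScheme p S] (f : X ⟶ S) :
    X ⟶ frobTwist p f :=
  pullback.lift (absFrob p X) f (absFrob_comp p f)

theorem relFrob_fst {X S : Scheme.{u}} [IsFpScheme p X] [IsFpScheme p S] (f : X ⟶ S) :
    relFrob p f ≫ pullback.fst f (absFrob p S) = absFrob p X :=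
  pullback.lift_fst _ _ _

theorem relFrob_snd {X S : Scheme.{u}} [IsFpScheme p X] [IsFpScheme p S] (f : X ⟶ S) :
    relFrob p f ≫ pullback.snd f (absFrob p S) = f :=
  pullback.lift_snd _ _ _

end RelFrob

/-! Locally the relative Frobenius is a ring map `C → B` of noetherian rings, formally unramified
because a composite `A → C → B` is, whose image contains every `b ^ p`. The claim is that such a map
is surjective (`algebraMap_surjective_of_formallyUnramified`).

By induction on the height of primes of `C`, one may take `C` local with `B / C` torsion for powers
of each `t` in the maximal ideal. Noetherian induction on ideals of `B` makes `C → B` injective,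
with `C → B / J` surjective for every `J ≠ 0`. A field `C`, or a `B` with zero divisors, is handled
directly.

There remains `t` regular in `B` with `B = C + tB` (`algebraMap_surjective_of_torsion`). Then `C →
B` is an epimorphism. The kernel `K` of the surjection `C⟦X⟧ → B⟦X⟧ / (X - t)` has a power inside
`(X - t)`, since `p`-th powers descend to `C⟦X⟧`. Being an epimorphism gives `C⟦X⟧ ⊗ B = C⟦X⟧ + K
(C⟦X⟧ ⊗ B)`; iterating replaces `K` by `(X - t)`. Thus `x = g + (X - t) e`, where `e` comes from the
tensor product and so has a bounded denominator `t ^ n`. Clearing it shows that `t ^ n * x` lies in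
`t ^ n C`, so `x` comes from `C`. -/

namespace RelFrob

open scoped TensorProduct PowerSeries

/-! ### Epimorphisms from formal unramification -/

section Epi

variable {C B : Type*} [CommRing C] [CommRing B] [Algebra C B]

theorem exists_add_pow_mul {t : C} (h : ∀ b : B, ∃ c u, b = algebraMap C B c + algebraMap C B t * u)
    (n : ℕ) (b : B) : ∃ c u, b = algebraMap C B c + algebraMap C B t ^ n * u := by
  induction n generalizing b with
  | zero => exact ⟨0, b, by simp⟩
  | succ n ih =>
    obtain ⟨c, u, rfl⟩ := ih b
    obtain ⟨d, v, rfl⟩ := h u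
    exact ⟨c + t ^ n * d, v, by simp only [map_add, map_mul, map_pow]; ring⟩

/-- If `B = C + tB` and `B / C` is `t`-power torsion, then the square of the kernel of
multiplication `B ⊗ B → B` vanishes, so `C → B` is an epimorphism once `Ω[B⁄C] = 0`. -/
theorem isEpi_of_formallyUnramified [Algebra.FormallyUnramified C B] {t : C}
    (h : ∀ b : B, ∃ c u, b = algebraMap C B c + algebraMap C B t * u)
    (htors : ∀ b : B, ∃ n c, algebraMap C B t ^ n * b = algebraMap C B c) :
    Algebra.IsEpi C B := by
  set I := KaehlerDifferential.ideal C B with hI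
  let δ : B → B ⊗[C] B := fun b => (1 : B) ⊗ₜ[C] b - b ⊗ₜ[C] (1 : B)
  have hδs : ∀ (c : C) b, δ (algebraMap C B c * b) = algebraMap C (B ⊗[C] B) c * δ b := by
    intro c b
    simp only [δ, ← Algebra.smul_def, smul_sub, TensorProduct.smul_tmul', TensorProduct.tmul_smul]
  have hδc : ∀ c : C, δ (algebraMap C B c) = 0 := by
    intro c
    simp only [δ, Algebra.algebraMap_eq_smul_one, TensorProduct.tmul_smul,
      TensorProduct.smul_tmul', sub_self]
  have hδa : ∀ a b, δ (a + b) = δ a + δ b := by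
    intro a b
    simp only [δ, TensorProduct.tmul_add, TensorProduct.add_tmul]; ring
  -- Modulo `C`, `b` is `t ^ n * u`; moving `t ^ n` to the other factor gives `δ (t ^ n * b') = 0`.
  have hmul : ∀ b b', δ b * δ b' = 0 := by
    intro b b'
    obtain ⟨n, c, hc⟩ := htors b'
    obtain ⟨d, u, rfl⟩ := exists_add_pow_mul h n b
    rw [hδa, hδc, zero_add, ← map_pow, hδs, mul_right_comm, mul_comm, ← hδs, map_pow, hc, hδc,
      mul_zero]
  have hspan : I = Ideal.span (Set.range δ) :=
    (KaehlerDifferential.span_range_eq_ideal C B).symm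
  have hidem : IsIdempotentElem I :=
    (Ideal.cotangent_subsingleton_iff _).mp (inferInstanceAs <| Subsingleton Ω[B⁄C])
  have hbot : I = ⊥ := by
    rw [← hidem.eq, hspan, Ideal.span_mul_span', Ideal.span_eq_bot]
    rintro _ ⟨_, ⟨b, rfl⟩, _, ⟨b', rfl⟩, rfl⟩
    exact hmul b b'
  refine (Algebra.isEpi_iff_forall_one_tmul_eq C B).mpr fun b => sub_eq_zero.mp ?_
  have := KaehlerDifferential.one_smul_sub_smul_one_mem_ideal C b
  rwa [← hI, hbot] at this

theorem algHom_ext_of_isEpi [Algebra.IsEpi C B] {E : Type*} [CommRing E] [Algebra C E]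
    (f g : B →ₐ[C] E) : f = g := by
  ext b
  have := congr(Algebra.TensorProduct.productMap f g
    $((Algebra.isEpi_iff_forall_one_tmul_eq C B).mp ‹_› b))
  simpa using this.symm

end Epi

/-! ### Division by `X - t` in power series rings -/

section PowerSeries

variable {C B : Type*} [CommRing C] [CommRing B] [Algebra C B]

/-- The power series `X - t`. -/
noncomputable def shift (t : C) : C⟦X⟧ := PowerSeries.X - PowerSeries.C t

theorem map_shift (t : C) :
    PowerSeries.map (algebraMap C B) (shift t) = shift (algebraMap C B t) := by
  simp [shift]

theorem coeff_zero_shift_mul (t : C) (f : C⟦X⟧) :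
    PowerSeries.coeff 0 (shift t * f) = - (t * PowerSeries.coeff 0 f) := by
  simp [shift, sub_mul]

theorem coeff_succ_shift_mul (t : C) (f : C⟦X⟧) (n : ℕ) :
    PowerSeries.coeff (n + 1) (shift t * f) =
      PowerSeries.coeff n f - t * PowerSeries.coeff (n + 1) f := by
  simp [shift, sub_mul, PowerSeries.coeff_succ_X_mul]

/-- The coefficients are solved recursively: `f_(n+1) - k_n = α + t β` forces the choice `g_(n+1) =
α`, `k_(n+1) = -β`. -/
theorem exists_map_add_shift_mul {t : C}
    (h : ∀ b : B, ∃ c u, b = algebraMap C B c + algebraMap C B t * u) (f : B⟦X⟧) :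
    ∃ (g : C⟦X⟧) (k : B⟦X⟧),
      f = PowerSeries.map (algebraMap C B) g + shift (algebraMap C B t) * k := by
  choose α β hαβ using h
  let k : ℕ → B := fun n => Nat.rec (-β (PowerSeries.coeff 0 f))
    (fun m km => -β (PowerSeries.coeff (m + 1) f - km)) n
  refine ⟨PowerSeries.mk fun n => Nat.casesOn n (α (PowerSeries.coeff 0 f))
    fun m => α (PowerSeries.coeff (m + 1) f - k m), PowerSeries.mk k, ?_⟩
  ext n
  rcases n with _ | n
  · rw [map_add, coeff_zero_shift_mul, PowerSeries.coeff_map, PowerSeries.coeff_mk,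
      PowerSeries.coeff_mk]
    refine (hαβ (PowerSeries.coeff 0 f)).trans ?_
    change _ = algebraMap C B (α (PowerSeries.coeff 0 f)) +
      -(_ * -β (PowerSeries.coeff 0 f))
    ring
  · rw [map_add, coeff_succ_shift_mul, PowerSeries.coeff_map, PowerSeries.coeff_mk,
      PowerSeries.coeff_mk, PowerSeries.coeff_mk]
    have := hαβ (PowerSeries.coeff (n + 1) f - k n)
    change _ = algebraMap C B (α (PowerSeries.coeff (n + 1) f - k n)) +
      (k n - _ * -β (PowerSeries.coeff (n + 1) f - k n))
    linear_combination this

/-- A constant in the ideal `(t ^ k, X - t)` of `C⟦X⟧` is divisible by `t ^ k` in `C`. -/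
theorem exists_eq_pow_mul_of_C_eq {t c : C} {f g : C⟦X⟧} {k : ℕ}
    (h : PowerSeries.C c = PowerSeries.C (t ^ k) * g + shift t * f) : ∃ d, c = t ^ k * d := by
  -- In positive degree, `f_n = t f_(n+1)` modulo `t ^ k`; substituting repeatedly makes the error
  -- term divisible by `t ^ k` as well.
  have key : ∀ n, ∃ d, c = t ^ k * d - t ^ (n + 1) * PowerSeries.coeff n f := by
    intro n
    induction n with
    | zero =>
      refine ⟨PowerSeries.coeff 0 g, ?_⟩
      have := congr(PowerSeries.coeff 0 $h)
      rw [map_add, coeff_zero_shift_mul, PowerSeries.coeff_C_mul, PowerSeries.coeff_zero_C] at this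
      linear_combination this
    | succ n ih =>
      obtain ⟨d, hd⟩ := ih
      have := congr(PowerSeries.coeff (n + 1) $h)
      rw [map_add, coeff_succ_shift_mul, PowerSeries.coeff_C_mul, PowerSeries.coeff_C,
        if_neg n.succ_ne_zero] at this
      exact ⟨d + t ^ (n + 1) * PowerSeries.coeff (n + 1) g, by
        linear_combination hd + t ^ (n + 1) * this⟩
  obtain ⟨d, hd⟩ := key k
  exact ⟨d - t * PowerSeries.coeff k f, by linear_combination hd⟩

end PowerSeries

/-! ### The case of `t`-power torsion cokernel -/

section Torsion

variable {C B : Type*} [CommRing C] [CommRing B] [Algebra C B]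

/-- The map `C⟦X⟧ → B⟦X⟧ / (X - t)`. -/
noncomputable def toQuotientShift (t : C) :
    C⟦X⟧ →ₐ[C] B⟦X⟧ ⧸ Ideal.span {shift (algebraMap C B t)} :=
  (Ideal.Quotient.mkₐ C _).comp (PowerSeries.mapAlgHom (Algebra.ofId C B))

theorem toQuotientShift_surjective {t : C}
    (h : ∀ b : B, ∃ c u, b = algebraMap C B c + algebraMap C B t * u) :
    Function.Surjective (toQuotientShift (B := B) t) := by
  intro y
  obtain ⟨f, rfl⟩ := Ideal.Quotient.mk_surjective y
  obtain ⟨g, k, rfl⟩ := exists_map_add_shift_mul h f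
  refine ⟨g, ?_⟩
  refine (Ideal.Quotient.eq.mpr ?_)
  rw [Ideal.mem_span_singleton]
  refine ⟨-k, ?_⟩
  change PowerSeries.map (algebraMap C B) g - _ = _
  ring

theorem mem_ker_toQuotientShift {t : C} {f : C⟦X⟧} :
    f ∈ RingHom.ker (toQuotientShift (B := B) t) ↔
      ∃ k, PowerSeries.map (algebraMap C B) f = shift (algebraMap C B t) * k := by
  rw [RingHom.mem_ker]
  refine (Ideal.Quotient.eq_zero_iff_mem).trans ?_
  rw [Ideal.mem_span_singleton]
  rfl

/-- In characteristic `p`, the coefficients of `f ^ p` are zero or `p`-th powers of coefficients of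
`f`. -/
theorem exists_map_eq_pow (p : ℕ) [Fact p.Prime] (hp : (p : B) = 0)
    (hpow : ∀ b : B, ∃ c, algebraMap C B c = b ^ p) (f : B⟦X⟧) :
    ∃ g, PowerSeries.map (algebraMap C B) g = f ^ p := by
  choose r hr using hpow
  rcases subsingleton_or_nontrivial B with hB | hB
  · exact ⟨0, Subsingleton.elim _ _⟩
  have : CharP B p := (CharP.charP_iff_prime_eq_zero Fact.out).mpr hp
  have hp0 : p ≠ 0 := (Fact.out : p.Prime).ne_zero
  refine ⟨PowerSeries.mk fun n => r (PowerSeries.coeff n (PowerSeries.expand p hp0 f)), ?_⟩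
  refine Eq.trans ?_ (MvPowerSeries.map_frobenius_expand p hp0 (f := f))
  ext n
  rw [PowerSeries.coeff_map, PowerSeries.coeff_mk, hr]
  exact (PowerSeries.coeff_map (frobenius B p) n (PowerSeries.expand p hp0 f)).symm

/-- If `f = (X - t) k` over `B`, then `f ^ p = (X - t) ^ p * k ^ p`, where `k ^ p` already lives
over `C`. -/
theorem ker_toQuotientShift_le_radical (p : ℕ) [Fact p.Prime] (hp : (p : B) = 0)
    (hinj : Function.Injective (algebraMap C B))
    (hpow : ∀ b : B, ∃ c, algebraMap C B c = b ^ p) (t : C) :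
    RingHom.ker (toQuotientShift (B := B) t) ≤ (Ideal.span {shift t}).radical := by
  intro f hf
  obtain ⟨k, hk⟩ := mem_ker_toQuotientShift.mp hf
  obtain ⟨g, hg⟩ := exists_map_eq_pow p hp hpow k
  refine ⟨p, Ideal.mem_span_singleton.mpr (Dvd.dvd.mul_right
    (dvd_pow_self _ (Fact.out : p.Prime).ne_zero) g |>.trans (dvd_of_eq ?_) :
      shift t ∣ f ^ p)⟩
  apply PowerSeries.map_injective _ hinj
  rw [map_mul, map_pow, map_pow, map_shift, hk, hg, mul_pow]

/-- Modulo the kernel, `C⟦X⟧` becomes a `B`-algebra. Maps of `C`-algebras out of `B` are unique, so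
`b ↦ 1 ⊗ b` factors through this quotient of `C⟦X⟧`. -/
theorem exists_one_tmul_eq [Algebra.IsEpi C B] {t : C}
    (h : ∀ b : B, ∃ c u, b = algebraMap C B c + algebraMap C B t * u) (b : B) :
    ∃ g : C⟦X⟧, (1 : C⟦X⟧) ⊗ₜ[C] b - g ⊗ₜ[C] (1 : B) ∈
      (RingHom.ker (toQuotientShift (B := B) t)).map (algebraMap C⟦X⟧ (C⟦X⟧ ⊗[C] B)) := by
  set K := RingHom.ker (toQuotientShift (B := B) t)
  set J := K.map (algebraMap C⟦X⟧ (C⟦X⟧ ⊗[C] B))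
  have hs := toQuotientShift_surjective h
  let e : (C⟦X⟧ ⧸ K) ≃ₐ[C] _ := Ideal.quotientKerAlgEquivOfSurjective hs
  let q : (C⟦X⟧ ⧸ K) →ₐ[C] (C⟦X⟧ ⊗[C] B) ⧸ J :=
    Ideal.quotientMapₐ J Algebra.TensorProduct.includeLeft Ideal.le_comap_map
  let i : B →ₐ[C] B⟦X⟧ ⧸ Ideal.span {shift (algebraMap C B t)} :=
    IsScalarTower.toAlgHom C B _
  obtain ⟨g, hg⟩ := hs (i b)
  refine ⟨g, Ideal.Quotient.eq.mp ?_⟩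
  have key := algHom_ext_of_isEpi (E := (C⟦X⟧ ⊗[C] B) ⧸ J) ((Ideal.Quotient.mkₐ C J).comp
    Algebra.TensorProduct.includeRight) (q.comp ((e.symm : _ →ₐ[C] _).comp i))
  refine (DFunLike.congr_fun key b).trans ?_
  change q (e.symm (i b)) = _
  rw [← hg, Ideal.quotientKerAlgEquivOfSurjective_symm_apply]
  rfl

theorem range_sup_pow_smul {R M : Type*} [CommRing R] [AddCommGroup M] [Module R M]
    {I : Ideal R} {N : Submodule R M} (h : N ⊔ I • ⊤ = ⊤) (n : ℕ) : N ⊔ I ^ n • ⊤ = ⊤ := by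
  induction n with
  | zero => simp
  | succ n ih =>
    refine top_le_iff.mp ?_
    conv_lhs => rw [← ih, ← h]
    rw [Submodule.smul_sup, pow_succ, mul_smul]
    exact sup_le le_sup_left (sup_le (Submodule.smul_le_right.trans le_sup_left) le_sup_right)

theorem algebraMap_surjective_of_torsion (p : ℕ) [Fact p.Prime] [IsNoetherianRing C]
    [Algebra.FormallyUnramified C B] (hp : (p : B) = 0)
    (hinj : Function.Injective (algebraMap C B))
    (hpow : ∀ b : B, ∃ c, algebraMap C B c = b ^ p) {t : C}
    (ht : algebraMap C B t ∈ nonZeroDivisors B)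
    (h : ∀ b : B, ∃ c u, b = algebraMap C B c + algebraMap C B t * u)
    (htors : ∀ b : B, ∃ n c, algebraMap C B t ^ n * b = algebraMap C B c) :
    Function.Surjective (algebraMap C B) := by
  intro x
  have : Algebra.IsEpi C B := isEpi_of_formallyUnramified h htors
  set K := RingHom.ker (toQuotientShift (B := B) t)
  obtain ⟨N, hN⟩ := Ideal.exists_pow_le_of_le_radical_of_fg
    (ker_toQuotientShift_le_radical p hp hinj hpow t) (IsNoetherian.noetherian _)
  let R : Submodule C⟦X⟧ (C⟦X⟧ ⊗[C] B) := LinearMap.range (Algebra.linearMap C⟦X⟧ (C⟦X⟧ ⊗[C] B))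
  have h1 : R ⊔ K • ⊤ = ⊤ := by
    refine top_le_iff.mp fun e _ => ?_
    induction e with
    | zero => exact zero_mem _
    | add a b ha hb => exact add_mem (ha trivial) (hb trivial)
    | tmul f b =>
      obtain ⟨g, hg⟩ := exists_one_tmul_eq h b
      have hf : f ⊗ₜ[C] b = f • ((1 : C⟦X⟧) ⊗ₜ[C] b : (C⟦X⟧ ⊗[C] B)) := by
        rw [TensorProduct.smul_tmul', smul_eq_mul, mul_one]
      rw [hf]
      refine Submodule.smul_mem _ _ ?_
      rw [← sub_add_cancel ((1 : C⟦X⟧) ⊗ₜ[C] b) (g ⊗ₜ[C] (1 : B))]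
      refine add_mem (Submodule.mem_sup_right ?_) (Submodule.mem_sup_left ⟨g, rfl⟩)
      rw [Ideal.smul_top_eq_map]
      exact hg
  have h2 : (1 : C⟦X⟧) ⊗ₜ[C] x ∈ R ⊔ Ideal.span {shift t} • (⊤ : Submodule C⟦X⟧ (C⟦X⟧ ⊗[C] B)) := by
    have : (1 : C⟦X⟧) ⊗ₜ[C] x ∈ R ⊔ K ^ N • ⊤ := by rw [range_sup_pow_smul h1]; trivial
    exact (sup_le_sup_left (Submodule.smul_mono_left hN) R) this
  obtain ⟨_, ⟨g, rfl⟩, y, hy, hgy⟩ := Submodule.mem_sup.mp h2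
  rw [Submodule.ideal_span_singleton_smul] at hy
  obtain ⟨e, -, rfl⟩ := (Submodule.mem_smul_pointwise_iff_exists _ _ _).mp hy
  let μ : C⟦X⟧ ⊗[C] B →ₐ[C] B⟦X⟧ := Algebra.TensorProduct.productMap
    (PowerSeries.mapAlgHom (Algebra.ofId C B)) (IsScalarTower.toAlgHom C B B⟦X⟧)
  have hμ : ∀ f b, μ (f ⊗ₜ b) = PowerSeries.map (algebraMap C B) f * PowerSeries.C b := fun _ _ => rfl
  -- A tensor is a finite sum, so one power of `t` clears all denominators; a general element of
  -- `B⟦X⟧` would not allow this.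
  have htμ : ∀ e, ∃ (n : ℕ) (f : C⟦X⟧), PowerSeries.C (algebraMap C B t ^ n) * μ e =
      PowerSeries.map (algebraMap C B) f := by
    intro e
    induction e with
    | zero => exact ⟨0, 0, by simp⟩
    | add a b ha hb =>
      obtain ⟨n, f, hf⟩ := ha
      obtain ⟨m, g, hg⟩ := hb
      refine ⟨n + m, PowerSeries.C (t ^ m) * f + PowerSeries.C (t ^ n) * g, ?_⟩
      simp only [map_add, map_mul, ← hf, ← hg, PowerSeries.map_C, map_pow, pow_add]
      ring
    | tmul f b =>
      obtain ⟨n, c, hc⟩ := htors b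
      refine ⟨n, PowerSeries.C c * f, ?_⟩
      rw [hμ, map_mul, PowerSeries.map_C, ← hc, map_mul]
      ring
  obtain ⟨n, f, hf⟩ := htμ e
  have hx : PowerSeries.C x = PowerSeries.map (algebraMap C B) g +
      shift (algebraMap C B t) * μ e := by
    have hsm : shift t • e = (shift t ⊗ₜ[C] (1 : B)) * e := Algebra.smul_def (shift t) e
    have hg : Algebra.linearMap C⟦X⟧ (C⟦X⟧ ⊗[C] B) g = g ⊗ₜ[C] (1 : B) := rfl
    have h3 := congr(μ $hgy)
    rw [hsm, hg, map_add, map_mul, hμ, hμ, hμ, map_one, map_one, mul_one, mul_one, one_mul,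
      map_shift] at h3
    exact h3.symm
  obtain ⟨c, hc⟩ : ∃ c, algebraMap C B t ^ n * x = algebraMap C B c := by
    refine ⟨t ^ n * PowerSeries.coeff 0 g - t * PowerSeries.coeff 0 f, ?_⟩
    have h3 := congr(PowerSeries.coeff 0 $hx)
    have h4 := congr(PowerSeries.coeff 0 $hf)
    rw [map_add, coeff_zero_shift_mul, PowerSeries.coeff_zero_C, PowerSeries.coeff_map] at h3
    rw [PowerSeries.coeff_C_mul, PowerSeries.coeff_map] at h4
    rw [h3, map_sub, map_mul, map_mul, map_pow, ← h4]
    ring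
  have key : PowerSeries.C c = PowerSeries.C (t ^ n) * g + shift t * f := by
    apply PowerSeries.map_injective _ hinj
    rw [map_add, map_mul, map_mul, map_shift, ← hf, PowerSeries.map_C, PowerSeries.map_C, ← hc,
      map_mul, hx, map_pow (algebraMap C B)]
    ring
  obtain ⟨d, rfl⟩ := exists_eq_pow_mul_of_C_eq key
  refine ⟨d, ?_⟩
  rw [map_mul, map_pow] at hc
  exact ((mul_cancel_left_mem_nonZeroDivisors (pow_mem ht n)).mp hc).symm

end Torsion

/-! ### Field extensions -/

section Field

variable {K L : Type*} [Field K] [Field L] [Algebra K L]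

open IntermediateField in
-- For `F` maximal among the subextensions missing `x`, every `y ∉ F` has degree `p` and `x ∈ F⟮y⟯`,
-- so `F⟮x⟯ = F⟮y⟯`. Hence `L = F⟮x⟯` is finite, purely inseparable and unramified over `F`, so
-- trivial.
theorem algebraMap_surjective_of_field (p : ℕ) [Fact p.Prime] [Algebra.FormallyUnramified K L]
    (hp : (p : L) = 0) (hpow : ∀ b : L, ∃ c, algebraMap K L c = b ^ p) :
    Function.Surjective (algebraMap K L) := by
  by_contra hsurj
  obtain ⟨x, hx⟩ := not_forall.mp hsurj
  have hx' : x ∉ (⊥ : IntermediateField K L) := fun h => hx (IntermediateField.mem_bot.mp h)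
  obtain ⟨F, hF⟩ := zorn_le₀ {F : IntermediateField K L | x ∉ F} (by
    intro c hc hchain
    rcases c.eq_empty_or_nonempty with rfl | hne
    · exact ⟨⊥, hx', by simp⟩
    · refine ⟨sSup c, fun hxc => ?_, fun z hz => le_sSup hz⟩
      have : Nonempty c := hne.to_subtype
      rw [sSup_eq_iSup', ← SetLike.mem_coe,
        IntermediateField.coe_iSup_of_directed hchain.directedOn.directed_val, Set.mem_iUnion] at hxc
      obtain ⟨G, hG⟩ := hxc
      exact hc G.2 hG)
  have hxF : x ∉ F := hF.prop
  have hpowF : ∀ b : L, ∃ c : F, algebraMap F L c = b ^ p := fun b => by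
    obtain ⟨c, hc⟩ := hpow b
    exact ⟨algebraMap K F c, hc⟩
  have hdeg : ∀ y ∉ F, Module.finrank F F⟮y⟯ = p ∧ IsIntegral F y := by
    intro y hy
    obtain ⟨a, ha⟩ := hpowF y
    have hint : IsIntegral F y :=
      ⟨Polynomial.X ^ p - Polynomial.C a,
        Polynomial.monic_X_pow_sub_C a (Fact.out : p.Prime).ne_zero, by simp [← ha]⟩
    have hirr : Irreducible (Polynomial.X ^ p - Polynomial.C a) := by
      refine X_pow_sub_C_irreducible_of_prime Fact.out fun b hb => hy ?_
      have : CharP L p := (CharP.charP_iff_prime_eq_zero Fact.out).mpr hp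
      have : (b : L) = y := by
        apply frobenius_inj L p
        change (b : L) ^ p = y ^ p
        rw [← ha, ← hb]; rfl
      exact this ▸ b.2
    refine ⟨?_, hint⟩
    rw [IntermediateField.adjoin.finrank hint,
      ← minpoly.eq_of_irreducible_of_monic hirr (by simp [← ha])
        (Polynomial.monic_X_pow_sub_C a (Fact.out : p.Prime).ne_zero),
      Polynomial.natDegree_X_pow_sub_C]
  have htop : F⟮x⟯ = ⊤ := by
    refine top_le_iff.mp fun y _ => ?_
    by_cases hy : y ∈ F
    · exact F⟮x⟯.algebraMap_mem ⟨y, hy⟩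
    · have hxy : x ∈ F⟮y⟯ := by
        by_contra hxy
        refine hy ((hF.le_of_ge (y := F⟮y⟯.restrictScalars K) hxy fun z hz =>
          F⟮y⟯.algebraMap_mem ⟨z, hz⟩) (mem_adjoin_simple_self F y))
      have hle : F⟮x⟯ ≤ F⟮y⟯ := adjoin_simple_le_iff.mpr hxy
      have := adjoin.finiteDimensional (hdeg y hy).2
      rw [IntermediateField.eq_of_le_of_finrank_eq hle ((hdeg x hxF).1.trans (hdeg y hy).1.symm)]
      exact mem_adjoin_simple_self F y
  have : FiniteDimensional F L := by
    have := adjoin.finiteDimensional (hdeg x hxF).2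
    rw [htop] at this
    exact Module.Finite.equiv (topEquiv (F := F) (E := L)).toLinearEquiv
  have : Algebra.FormallyUnramified F L := Algebra.FormallyUnramified.of_restrictScalars K F L
  have : CharP F p := (CharP.charP_iff_prime_eq_zero Fact.out).mpr
    (Subtype.ext (by simpa using hp))
  have : ExpChar F p := ExpChar.prime Fact.out
  have : IsPurelyInseparable F L := (isPurelyInseparable_iff_pow_mem F p).mpr fun y =>
    ⟨1, by simpa using hpowF y⟩
  have hr := Algebra.FormallyUnramified.range_eq_top_of_isPurelyInseparable F L
  obtain ⟨⟨z, hz⟩, rfl⟩ : x ∈ (algebraMap F L).range := hr ▸ trivial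
  exact hxF hz

end Field

/-! ### Local base rings -/

section Local

variable {C B : Type*} [CommRing C] [CommRing B] [Algebra C B]

/-- If `C` is a field and `C → B / J` is surjective for all nonzero ideals `J`, then so is
`C → B`. -/
theorem algebraMap_surjective_of_isField (p : ℕ) [Fact p.Prime]
    [Algebra.FormallyUnramified C B] (hp : (p : B) = 0)
    (hinj : Function.Injective (algebraMap C B))
    (hpow : ∀ b : B, ∃ c, algebraMap C B c = b ^ p) (hC : IsField C)
    (hquot : ∀ J : Ideal B, J ≠ ⊥ → ∀ b, ∃ c, b - algebraMap C B c ∈ J) :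
    Function.Surjective (algebraMap C B) := by
  let := hC.toField
  have : Nontrivial B := hinj.nontrivial
  by_cases hB : IsField B
  · let := hB.toField
    exact algebraMap_surjective_of_field p hp hpow
  obtain ⟨a, ha0, hau⟩ : ∃ a : B, a ≠ 0 ∧ ¬ IsUnit a := by
    by_contra! h
    exact hB ⟨exists_pair_ne B, mul_comm, fun {a} ha => (h a ha).exists_right_inv⟩
  have hap : a ^ p = 0 := by
    obtain ⟨c, hc⟩ := hpow a
    rcases eq_or_ne c 0 with rfl | hc0
    · rw [← hc, map_zero]
    · refine absurd ((isUnit_pow_iff (Fact.out : p.Prime).ne_zero).mp ?_) hau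
      exact hc ▸ (IsUnit.mk0 c hc0).map (algebraMap C B)
  set J := Ideal.span {a}
  have : Nontrivial (B ⧸ J) := Ideal.Quotient.nontrivial_iff.mpr
    (by rwa [Ne, Ideal.span_singleton_eq_top])
  have hJ : J ≠ ⊥ := by rwa [Ne, Ideal.span_singleton_eq_bot]
  let e : C ≃ₐ[C] B ⧸ J := AlgEquiv.ofBijective (Algebra.ofId C _) ⟨(algebraMap C (B ⧸ J)).injective,
    fun y => by
      obtain ⟨b, rfl⟩ := Ideal.Quotient.mk_surjective y
      obtain ⟨c, hc⟩ := hquot J hJ b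
      exact ⟨c, (Ideal.Quotient.eq.mpr hc).symm⟩⟩
  -- The identity and `B → B / J ≃ C → B` agree modulo the nilpotent ideal `J`, so formal
  -- unramification identifies them.
  have key : AlgHom.id C B =
      ((Algebra.ofId C B).comp (e.symm : _ →ₐ[C] _)).comp (Ideal.Quotient.mkₐ C J) := by
    refine Algebra.FormallyUnramified.ext J ⟨p, ?_⟩ fun x => ?_
    · rw [Ideal.span_singleton_pow, hap]; simp
    · exact (e.apply_symm_apply (Ideal.Quotient.mk J x)).symm
  exact fun b => ⟨_, (DFunLike.congr_fun key b).symm⟩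

theorem algebraMap_surjective_of_forall_quotient (p : ℕ) [Fact p.Prime] [IsNoetherianRing C]
    [IsLocalRing C] [Algebra.FormallyUnramified C B] (hp : (p : B) = 0)
    (hinj : Function.Injective (algebraMap C B))
    (hpow : ∀ b : B, ∃ c, algebraMap C B c = b ^ p)
    (htors : ∀ t ∈ IsLocalRing.maximalIdeal C, ∀ b : B, ∃ n c,
      algebraMap C B t ^ n * b = algebraMap C B c)
    (hquot : ∀ J : Ideal B, J ≠ ⊥ → ∀ b, ∃ c, b - algebraMap C B c ∈ J) :
    Function.Surjective (algebraMap C B) := by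
  by_cases hC : IsLocalRing.maximalIdeal C = ⊥
  · exact algebraMap_surjective_of_isField p hp hinj hpow
      (IsLocalRing.isField_iff_maximalIdeal_eq.mpr hC) hquot
  obtain ⟨t, htm, ht0⟩ := Submodule.exists_mem_ne_zero_of_ne_bot hC
  have hdiv : ∀ a : B, a ≠ 0 → ∀ b : B, ∃ c u, b = algebraMap C B c + a * u := by
    intro a ha b
    obtain ⟨c, hc⟩ := hquot (Ideal.span {a}) (by rwa [Ne, Ideal.span_singleton_eq_bot]) b
    obtain ⟨u, hu⟩ := Ideal.mem_span_singleton.mp hc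
    exact ⟨c, u, by rw [← hu]; ring⟩
  have ht0' : algebraMap C B t ≠ 0 := fun h => ht0 (hinj (h.trans (map_zero _).symm))
  by_cases hB : NoZeroDivisors B
  · exact algebraMap_surjective_of_torsion p hp hinj hpow (mem_nonZeroDivisors_of_ne_zero ht0')
      (hdiv _ ht0') (htors t htm)
  obtain ⟨a, b, hab, ha, hb⟩ : ∃ a b : B, a * b = 0 ∧ a ≠ 0 ∧ b ≠ 0 := by
    by_contra! h
    exact hB ⟨fun {a b} hab => or_iff_not_imp_left.mpr fun ha => h a b hab ha⟩
  -- From `B = C + aB`, `B = C + bB` and `ab = 0` follows `B = C + Ca`; Nakayama then applies.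
  have hfin : (⊤ : Submodule C B).FG := by
    refine (top_le_iff.mp fun x _ => ?_ : Submodule.span C {1, a} = ⊤) ▸
      Submodule.fg_span (Set.toFinite _)
    obtain ⟨c, y, rfl⟩ := hdiv a ha x
    obtain ⟨d, z, rfl⟩ := hdiv b hb y
    have : algebraMap C B c + a * (algebraMap C B d + b * z) = c • (1 : B) + d • a := by
      rw [Algebra.smul_def, Algebra.smul_def]
      linear_combination z * hab
    rw [this]
    exact add_mem (Submodule.smul_mem _ _ (Submodule.subset_span (by simp)))
      (Submodule.smul_mem _ _ (Submodule.subset_span (by simp)))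
  have hle : (⊤ : Submodule C B) ≤ LinearMap.range (Algebra.linearMap C B) := by
    refine Submodule.le_of_le_smul_of_le_jacobson_bot (I := IsLocalRing.maximalIdeal C) hfin
      (IsLocalRing.jacobson_eq_maximalIdeal ⊥ bot_ne_top).ge fun x _ => ?_
    obtain ⟨c, u, rfl⟩ := hdiv _ ht0' x
    rw [← Algebra.smul_def]
    exact add_mem (Submodule.mem_sup_left ⟨c, rfl⟩)
      (Submodule.mem_sup_right (Submodule.smul_mem_smul htm trivial))
  exact fun x => hle (Submodule.mem_top (x := x))

theorem algebraMap_surjective_of_isLocalRing (p : ℕ) [Fact p.Prime] [IsNoetherianRing C]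
    [IsNoetherianRing B] [IsLocalRing C] [Algebra.FormallyUnramified C B] (hp : (p : B) = 0)
    (hpow : ∀ b : B, ∃ c, algebraMap C B c = b ^ p)
    (htors : ∀ t ∈ IsLocalRing.maximalIdeal C, ∀ b : B, ∃ n c,
      algebraMap C B t ^ n * b = algebraMap C B c) :
    Function.Surjective (algebraMap C B) := by
  have key : ∀ J : Ideal B, ∀ b, ∃ c, b - algebraMap C B c ∈ J := by
    -- Noetherian induction: all larger ideals are settled, so `C ⧸ I → B ⧸ J` is injective and
    -- surjective modulo every nonzero ideal.
    intro J
    induction J using WellFoundedGT.induction with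
    | _ J ih =>
    rcases eq_or_ne J ⊤ with rfl | hJ
    · exact fun b => ⟨0, trivial⟩
    set I := J.comap (algebraMap C B)
    have : Nontrivial (C ⧸ I) := Ideal.Quotient.nontrivial_iff.mpr (Ideal.comap_ne_top _ hJ)
    have : IsLocalRing (C ⧸ I) := .of_surjective' (Ideal.Quotient.mk I) Ideal.Quotient.mk_surjective
    have : IsScalarTower C (C ⧸ I) (B ⧸ J) := .of_algebraMap_eq fun _ => rfl
    have : Algebra.FormallyUnramified (C ⧸ I) (B ⧸ J) := .of_restrictScalars C _ _
    have hmk : ∀ c, algebraMap (C ⧸ I) (B ⧸ J) (Ideal.Quotient.mk I c) =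
      Ideal.Quotient.mk J (algebraMap C B c) := fun _ => rfl
    have hs : Function.Surjective (algebraMap (C ⧸ I) (B ⧸ J)) := by
      refine algebraMap_surjective_of_forall_quotient p ?_ Ideal.algebraMap_quotient_injective
        ?_ ?_ ?_
      · rw [← map_natCast (Ideal.Quotient.mk J), hp, map_zero]
      · intro b
        obtain ⟨b, rfl⟩ := Ideal.Quotient.mk_surjective b
        obtain ⟨c, hc⟩ := hpow b
        exact ⟨Ideal.Quotient.mk I c, by rw [hmk, hc, map_pow]⟩
      · intro t ht b
        obtain ⟨b, rfl⟩ := Ideal.Quotient.mk_surjective b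
        obtain ⟨t, rfl⟩ := Ideal.Quotient.mk_surjective t
        obtain ⟨n, c, hc⟩ := htors t (fun hu => ht (hu.map (Ideal.Quotient.mk I))) b
        exact ⟨n, Ideal.Quotient.mk I c, by rw [hmk, hmk, ← hc, map_mul, map_pow]⟩
      · intro J' hJ' b
        obtain ⟨b, rfl⟩ := Ideal.Quotient.mk_surjective b
        obtain ⟨c, hc⟩ := ih (J'.comap (Ideal.Quotient.mk J)) (by
          refine lt_of_le_of_ne (fun x hx => ?_) fun h => hJ' ?_
          · rw [Ideal.mem_comap, Ideal.Quotient.eq_zero_iff_mem.mpr hx]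
            exact zero_mem _
          · rw [← Ideal.map_comap_of_surjective _ Ideal.Quotient.mk_surjective J', ← h,
              Ideal.map_quotient_self]) b
        exact ⟨Ideal.Quotient.mk I c, by rwa [hmk, ← map_sub]⟩
    intro b
    obtain ⟨c, hc⟩ := hs (Ideal.Quotient.mk J b)
    obtain ⟨c, rfl⟩ := Ideal.Quotient.mk_surjective c
    exact ⟨c, Ideal.Quotient.eq.mp (hc.symm.trans (hmk c))⟩
  intro b
  obtain ⟨c, hc⟩ := key ⊥ b
  exact ⟨c, (sub_eq_zero.mp hc).symm⟩

end Local

/-! ### From local to global by induction on height -/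

section Global

variable {C B : Type*} [CommRing C] [CommRing B] [Algebra C B]

/-- The ideal of those `c` with `c * b` in the image of `C`. -/
def conductorAt (C : Type*) {B : Type*} [CommRing C] [CommRing B] [Algebra C B] (b : B) :
    Ideal C :=
  (LinearMap.range (Algebra.linearMap C B)).comap (LinearMap.toSpanSingleton C B b)

theorem mem_conductorAt {b : B} {c : C} :
    c ∈ conductorAt C b ↔ ∃ d, algebraMap C B c * b = algebraMap C B d := by
  rw [← Algebra.smul_def]
  exact exists_congr fun _ => eq_comm

open Algebra in
theorem not_conductorAt_le (p : ℕ) [Fact p.Prime] [IsNoetherianRing C] [IsNoetherianRing B]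
    [FormallyUnramified C B] (hp : (p : B) = 0)
    (hpow : ∀ b : B, ∃ c, algebraMap C B c = b ^ p) (q : Ideal C) [hq : q.IsPrime] (b : B) :
    ¬ conductorAt C b ≤ q := by
  induction hn : q.height using WellFoundedLT.induction generalizing q b with
  | _ n ih =>
  let S := algebraMapSubmonoid B q.primeCompl
  let Cq := Localization.AtPrime q
  let Bq := Localization S
  let : Algebra Cq Bq := localizationAlgebra q.primeCompl B
  have : IsScalarTower C Cq Bq := IsScalarTower.of_algebraMap_eq fun c =>
    (IsLocalization.map_eq (M := q.primeCompl) (T := S) (S := Cq) (Q := Bq) _ c).symm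
  have : IsNoetherianRing Cq := IsLocalization.isNoetherianRing q.primeCompl Cq ‹_›
  have : IsNoetherianRing Bq := IsLocalization.isNoetherianRing S Bq ‹_›
  have : FormallyUnramified Cq Bq := .of_restrictScalars C _ _
  have hCB : ∀ c, algebraMap Cq Bq (algebraMap C Cq c) = algebraMap B Bq (algebraMap C B c) :=
    fun c => by rw [← IsScalarTower.algebraMap_apply, ← IsScalarTower.algebraMap_apply]
  have hunit : ∀ s ∉ q, IsUnit (algebraMap C Cq s) := fun s hs =>
    IsLocalization.map_units (M := q.primeCompl) Cq ⟨s, hs⟩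
  have hrep : ∀ y : Bq, ∃ s ∉ q, ∃ x : B,
      algebraMap Cq Bq (algebraMap C Cq s) * y = algebraMap B Bq x := by
    intro y
    obtain ⟨⟨x, _, s, hs, rfl⟩, h⟩ := IsLocalization.surj (M := S) y
    exact ⟨s, hs, x, by rw [hCB, ← h, mul_comm]⟩
  have hs : Function.Surjective (algebraMap Cq Bq) := by
    refine algebraMap_surjective_of_isLocalRing p ?_ ?_ ?_
    · rw [← map_natCast (algebraMap B Bq), hp, map_zero]
    · intro y
      obtain ⟨s, hs, x, hx⟩ := hrep y
      obtain ⟨c, hc⟩ := hpow x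
      obtain ⟨u, hu⟩ := ((hunit s hs).pow p).exists_left_inv
      refine ⟨u * algebraMap C Cq c, ?_⟩
      rw [map_mul, hCB, hc, map_pow, ← hx, mul_pow, ← mul_assoc, ← map_pow, ← map_mul, hu,
        map_one, one_mul]
    · intro t ht y
      -- A prime `P` containing the conductor but not `t` contracts to a prime strictly below `q`,
      -- of smaller height, contradicting the induction hypothesis.
      have hrad : t ∈ (conductorAt Cq y).radical := by
        rw [Ideal.radical_eq_sInf, Submodule.mem_sInf]
        rintro (P : Ideal Cq) ⟨hP, hPp⟩
        by_contra htP
        have hr : Ideal.comap (algebraMap C Cq) P < q := by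
          refine lt_of_le_of_ne (fun c hc => ?_) fun h => htP ?_
          · by_contra hcq
            exact hPp.ne_top (Ideal.eq_top_of_isUnit_mem _ hc (hunit c hcq))
          · obtain ⟨⟨a, s⟩, ha⟩ := IsLocalization.surj (M := q.primeCompl) t
            have haq : a ∈ q := by
              by_contra haq
              exact ht (isUnit_of_mul_isUnit_left (ha ▸ hunit a haq))
            rw [← h] at haq
            refine (hPp.mem_or_mem (show t * algebraMap C Cq s ∈ P from ha ▸ haq)).resolve_right
              fun hsP => ?_
            exact hPp.ne_top (Ideal.eq_top_of_isUnit_mem _ hsP (hunit s s.2))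
        obtain ⟨s, hs, x, hx⟩ := hrep y
        have hlt := Ideal.height_strict_mono_of_isPrime_of_isPrime hr
        refine ih _ (hn ▸ hlt) (Ideal.comap (algebraMap C Cq) P) x rfl fun c hc => ?_
        obtain ⟨d, hd⟩ := mem_conductorAt.mp hc
        have : algebraMap C Cq c * algebraMap C Cq s ∈ P := hP (mem_conductorAt.mpr
          ⟨algebraMap C Cq d, by rw [map_mul, mul_assoc, hx, hCB, hCB, ← map_mul, hd]⟩)
        exact (hPp.mem_or_mem this).resolve_right
          fun hsP => hPp.ne_top (Ideal.eq_top_of_isUnit_mem _ hsP (hunit s hs))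
      obtain ⟨n, hn⟩ := hrad
      obtain ⟨d, hd⟩ := mem_conductorAt.mp hn
      exact ⟨n, d, by rw [← hd, map_pow]⟩
  intro hle
  obtain ⟨y, hy⟩ := hs (algebraMap B Bq b)
  obtain ⟨⟨c, s⟩, hc⟩ := IsLocalization.surj (M := q.primeCompl) y
  have h1 : algebraMap B Bq (algebraMap C B s * b) = algebraMap B Bq (algebraMap C B c) := by
    rw [← hCB, ← hc, map_mul, map_mul, hy, hCB, mul_comm]
  obtain ⟨⟨_, u, hu, rfl⟩, h2⟩ := IsLocalization.exists_of_eq (M := S) h1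
  have h3 : u * s ∈ conductorAt C b := mem_conductorAt.mpr
    ⟨u * c, by rw [map_mul, map_mul, mul_assoc]; exact h2⟩
  exact (hq.mem_or_mem (hle h3)).elim hu s.2

/-- Let `C → B` be a formally unramified homomorphism of noetherian `𝔽_p`-algebras such that the
image of `C` contains all `p`-th powers of `B`. Then it is surjective. -/
theorem algebraMap_surjective_of_formallyUnramified (p : ℕ) [Fact p.Prime] [IsNoetherianRing C]
    [IsNoetherianRing B] [Algebra.FormallyUnramified C B] (hp : (p : B) = 0)
    (hpow : ∀ b : B, ∃ c, algebraMap C B c = b ^ p) : Function.Surjective (algebraMap C B) := by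
  intro b
  by_cases h : conductorAt C b = ⊤
  · obtain ⟨d, hd⟩ := mem_conductorAt.mp ((Ideal.eq_top_iff_one _).mp h)
    exact ⟨d, by rw [← hd, map_one, one_mul]⟩
  · obtain ⟨M, hM, hle⟩ := Ideal.exists_le_maximal _ h
    have := hM.isPrime
    exact absurd hle (not_conductorAt_le p hp hpow M b)

end Global

theorem surjective_of_formallyUnramified {A R B : Type*} [CommRing A] [CommRing R] [CommRing B]
    (p : ℕ) [Fact p.Prime] [IsNoetherianRing R] [IsNoetherianRing B] (hp : (p : B) = 0)
    (i : A →+* R) (φ : R →+* B) (h : (φ.comp i).FormallyUnramified)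
    (hpow : ∀ b : B, ∃ c, φ c = b ^ p) : Function.Surjective φ := by
  algebraize [i, φ, φ.comp i]
  have : Algebra.FormallyUnramified R B := .of_restrictScalars A R B
  exact algebraMap_surjective_of_formallyUnramified p hp hpow

/-! ### Reduction from schemes to rings -/

theorem isAffineOpen_fst_inf_snd {X Y Z : Scheme.{u}} {f : X ⟶ Z} {g : Y ⟶ Z}
    {U : X.Opens} (hU : IsAffineOpen U) {V : Y.Opens} (hV : IsAffineOpen V)
    {W : Z.Opens} (hW : IsAffineOpen W) (hUW : U ≤ f ⁻¹ᵁ W) (hVW : V ≤ g ⁻¹ᵁ W) :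
    IsAffineOpen (pullback.fst f g ⁻¹ᵁ U ⊓ pullback.snd f g ⁻¹ᵁ V) := by
  have : IsAffine U.toScheme := hU
  have : IsAffine V.toScheme := hV
  have : IsAffine W.toScheme := hW
  let q : pullback (f.resLE _ _ hUW) (g.resLE _ _ hVW) ⟶ pullback f g :=
    pullback.map _ _ _ _ U.ι V.ι W.ι (by simp) (by simp)
  have : q.opensRange = pullback.fst f g ⁻¹ᵁ U ⊓ pullback.snd f g ⁻¹ᵁ V := by
    refine Opens.ext ((Scheme.Pullback.range_map _ _ _ _ _ _ _ _ _).trans ?_)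
    simp
  rw [← this]
  exact isAffineOpen_opensRange q

/-- A morphism is a closed immersion if the target is covered by affine opens with affine preimage
on which it is surjective on sections. -/
theorem isClosedImmersion_of_forall_exists {X Y : Scheme.{u}} (f : X ⟶ Y)
    (H : ∀ y : Y, ∃ U : Y.Opens, y ∈ U ∧ IsAffineOpen U ∧ IsAffineOpen (f ⁻¹ᵁ U) ∧
      Function.Surjective (f.app U)) : IsClosedImmersion f := by
  choose U hyU hU hfU hs using H
  refine (IsZariskiLocalAtTarget.iff_of_iSup_eq_top (P := @IsClosedImmersion) U
    (top_le_iff.mp fun y _ => Opens.mem_iSup.mpr ⟨y, hyU y⟩)).mpr fun y => ?_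
  have : IsAffine (U y).toScheme := hU y
  have : IsAffine (f ⁻¹ᵁ U y).toScheme := hfU y
  have hs' : ∀ V, V = U y → Function.Surjective (f.app V) := by
    rintro _ rfl
    exact hs y
  refine IsClosedImmersion.of_surjective_of_isAffine _ ?_
  rw [morphismRestrict_appTop]
  have hmap := (ConcreteCategory.bijective_of_isIso
    (X.presheaf.map (eqToHom (image_morphismRestrict_preimage f (U y) ⊤)).op)).2
  exact hmap.comp (hs' _ (U y).ι_image_top)

theorem absFrob_appLE (p : ℕ) [Fact p.Prime] (X : Scheme.{u}) [IsFpScheme p X] (V : X.Opens)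
    (e : V ≤ absFrob p X ⁻¹ᵁ V) (b : Γ(X, V)) : ((absFrob p X).appLE V V e).hom b = b ^ p :=
  congr($(X.presheaf.map_id (op V)).hom (b ^ p))

/-- The second projection exhibits `f` as a composite through the relative Frobenius, giving
unramification; the first projection puts all `p`-th powers in the image. -/
theorem relFrob_app_surjective (p : ℕ) [Fact p.Prime] {X S : Scheme.{u}} [IsFpScheme p X]
    [IsFpScheme p S] (f : X ⟶ S) [IsLocallyNoetherian X] [IsLocallyNoetherian (frobTwist p f)]
    [FormallyUnramified f] {V : X.Opens} (hV : IsAffineOpen V) {U : S.Opens} (hU : IsAffineOpen U)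
    (hVU : V ≤ f ⁻¹ᵁ U) {W : (frobTwist p f).Opens} (hW : IsAffineOpen W)
    (hfst : W ≤ pullback.fst f (absFrob p S) ⁻¹ᵁ V)
    (hsnd : W ≤ pullback.snd f (absFrob p S) ⁻¹ᵁ U) (hVW : V ≤ relFrob p f ⁻¹ᵁ W) :
    Function.Surjective ((relFrob p f).appLE W V hVW) := by
  have : IsNoetherianRing Γ(X, V) := IsLocallyNoetherian.component_noetherian ⟨V, hV⟩
  have : IsNoetherianRing Γ(frobTwist p f, W) := IsLocallyNoetherian.component_noetherian ⟨W, hW⟩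
  refine surjective_of_formallyUnramified p (natCast_eq_zero p X V)
    ((pullback.snd f (absFrob p S)).appLE U W hsnd).hom
    ((relFrob p f).appLE W V hVW).hom ?_ fun b => ?_
  · rw [← CommRingCat.hom_comp, Scheme.Hom.appLE_comp_appLE]
    have := Scheme.Hom.formallyUnramified_appLE f hU hV hVU
    convert this using 3
    exact relFrob_snd p f
  · refine ⟨((pullback.fst f (absFrob p S)).appLE V W hfst).hom b, ?_⟩
    rw [← CommRingCat.comp_apply, Scheme.Hom.appLE_comp_appLE]
    have key : ∀ (g : X ⟶ X) (e : V ≤ g ⁻¹ᵁ V), g = absFrob p X → (g.appLE V V e).hom b = b ^ p := by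
      rintro _ e rfl
      exact absFrob_appLE p X V e b
    exact key _ _ (relFrob_fst p f)

end RelFrob

theorem mainTheorem1 (p : ℕ) [Fact p.Prime] {X S : Scheme.{u}}
    [RelFrob.IsFpScheme p X] [RelFrob.IsFpScheme p S] (f : X ⟶ S)
    [IsLocallyNoetherian X] [IsLocallyNoetherian (RelFrob.frobTwist p f)]
    (hf : FormallyUnramified f) :
    IsClosedImmersion (RelFrob.relFrob p f) := by
  refine RelFrob.isClosedImmersion_of_forall_exists _ fun y => ?_
  let x := pullback.fst f (RelFrob.absFrob p S) y
  obtain ⟨_, ⟨U, hU, rfl⟩, hxU, -⟩ :=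
    S.isBasis_affineOpens.exists_subset_of_mem_open (Set.mem_univ (f x)) isOpen_univ
  obtain ⟨_, ⟨V, hV, rfl⟩, hxV, hVU⟩ :=
    X.isBasis_affineOpens.exists_subset_of_mem_open (show x ∈ f ⁻¹ᵁ U from hxU) (f ⁻¹ᵁ U).2
  let W := pullback.fst f (RelFrob.absFrob p S) ⁻¹ᵁ V ⊓ pullback.snd f (RelFrob.absFrob p S) ⁻¹ᵁ U
  have hW : IsAffineOpen W := RelFrob.isAffineOpen_fst_inf_snd hV hU hU hVU le_rfl
  -- The absolute Frobenius is the identity on points, and `V` already maps into `U`.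
  have hpre : RelFrob.relFrob p f ⁻¹ᵁ W = V := by
    refine le_antisymm (fun z hz => ?_) fun z hz => ⟨?_, ?_⟩
    · have h1 : (RelFrob.relFrob p f ≫ pullback.fst f (RelFrob.absFrob p S)) z ∈ V := hz.1
      rwa [RelFrob.relFrob_fst] at h1
    · change (RelFrob.relFrob p f ≫ pullback.fst f (RelFrob.absFrob p S)) z ∈ V
      rwa [RelFrob.relFrob_fst]
    · change (RelFrob.relFrob p f ≫ pullback.snd f (RelFrob.absFrob p S)) z ∈ U
      rw [RelFrob.relFrob_snd]
      exact hVU hz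
  refine ⟨W, ⟨hxV, ?_⟩, hW, hpre ▸ hV, ?_⟩
  · have h1 : (pullback.snd f (RelFrob.absFrob p S) ≫ RelFrob.absFrob p S) y ∈ U := by
      rw [← pullback.condition]
      exact hxU
    exact h1
  · have h1 := RelFrob.relFrob_app_surjective p f (V := RelFrob.relFrob p f ⁻¹ᵁ W) (hpre ▸ hV) hU
      (hpre ▸ hVU) hW (hpre ▸ inf_le_left) inf_le_right le_rfl
    rwa [Scheme.Hom.appLE_eq_app] at h1
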